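/- Let $\Lambda$ be a connected $k$-graph: a countable category with a degree functor $d:\Lambda\to\mathbb N^k$ such that, whenever $d(\lambda)=m+n$, there are unique $\mu,\nu$ with $d(\mu)=m$, $d(\nu)=n$ and $\lambda=\mu\nu$; connected means that the equivalence relation on the set $\Lambda^0$ of objects generated by $u\sim w\iff u\Lambda w\neq\emptyset$ relates all pairs of objects. Write $\Lambda^m=d^{-1}(m)$, let $e_1,\dots,e_k$ be the canonical generators of $\mathbb N^k$, and let $r,s$ be the range (codomain) and source (domain) maps. Paths are written so that $\mu_1\mu_2$ is composable when $s(\mu_1)=r(\mu_2)$. Let $\mathrm{Sk}_\Lambda$ be the directed graph with vertex set $\Lambda^0$ and edge set $\bigcup_i\Lambda^{e_i}$. The fundamental groupoid $\mathcal G(\Lambda)$ is the quotient of the category of undirected paths $h=h_1^{m_1}\cdots h_n^{m_n}$ in $\mathrm{Sk}_\Lambda$ (each $h_l$ an edge, $m_l=\pm1$) by the relations $e^{-1}e=s(e)$ and $ee^{-1}=r(e)$ for every edge $e$, and $ef=gh$ and $f^{-1}e^{-1}=h^{-1}g^{-1}$ whenever $e,h\in\Lambda^{e_i}$, $f,g\in\Lambda^{e_j}$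 with $i\neq j$ and $ef=gh$ in $\Lambda$. For $v\in\Lambda^0$ let $\pi_1(\Lambda,v)=v\,\mathcal G(\Lambda)\,v$. Let $C_0,C_1,C_2$ be the free abelian groups on $\Lambda^0$, on $\bigcup_i\Lambda^{e_i}$ and on $\bigcup_{i<j}\Lambda^{e_i+e_j}$, and define $\partial_1:C_1\to C_0$ by $\partial_1(e)=s(e)-r(e)$ and $\partial_2:C_2\to C_1$ by $\partial_2(\lambda)=f_1+g_1-f_2-g_2$, where $\lambda=f_1g_1=g_2f_2$ with $f_1,f_2\in\Lambda^{e_i}$, $g_1,g_2\in\Lambda^{e_j}$ and $i<j$. Put $H_1(\Lambda)=\ker\partial_1/\operatorname{Im}\partial_2$. For an undirected path $h=h_1^{m_1}\cdots h_n^{m_n}$ in $\mathrm{Sk}_\Lambda$ let $t(h)=\sum_{l=1}^n m_l h_l\in C_1$ be its trail. Then for every $v\in\Lambda^0$ the map $t$ induces an isomorphism $\operatorname{Ab}\pi_1(\Lambda,v)\cong H_1(\Lambda)$. That is, $t(h)\in\ker\partial_1$ for every undirected path $h$ from $v$ to $v$, and there is a group isomorphism from the abelianisation of $\pi_1(\Lambda,v)$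 onto $H_1(\Lambda)$ which sends the class of $h$ to the class of $t(h)$, for every such $h$. -/

import Mathlib

open CategoryTheory

universe w u

/-- A `k`-graph with underlying category `Λ`: a countable category with a degree functor
`d : Λ → ℕ^k` having the factorisation property.

A morphism `lam` of the `k`-graph with source `u` and range `v` is a Mathlib morphism `u ⟶ v`, so the
composite written `μν` in the literature (first `ν`, then `μ`) is `ν ≫ μ` here. -/
structure KGraph (k : ℕ) (Λ : Type u) [Category.{w} Λ] where
  countable_obj : Countable Λ
  countable_hom : ∀ u v : Λ, Countable (u ⟶ v)
  /-- the degree functor -/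
  d : ∀ {u v : Λ}, (u ⟶ v) → (Fin k → ℕ)
  d_id : ∀ u : Λ, d (𝟙 u) = 0
  d_comp : ∀ {u v x : Λ} (f : u ⟶ v) (g : v ⟶ x), d (f ≫ g) = d f + d g
  /-- If `d lam = m + n`, then `lam = μν` for unique `μ` and `ν` with `d μ = m` and `d ν = n`.
  A triple `⟨x, ν, μ⟩` consists of the middle vertex and the two factors. -/
  factorisation : ∀ {u v : Λ} (lam : u ⟶ v) (m n : Fin k → ℕ), d lam = m + n →
    ∃! p : Σ x : Λ, (u ⟶ x) × (x ⟶ v),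
      d p.2.2 = m ∧ d p.2.1 = n ∧ p.2.1 ≫ p.2.2 = lam

namespace KGraph

variable {k : ℕ} {Λ : Type u} [Category.{w} Λ] (G : KGraph k Λ)

/-- The canonical generator `e_i` of `ℕ^k`. -/
def gen {k : ℕ} (i : Fin k) : Fin k → ℕ := Pi.single i 1

/-- `Λ` is connected: the equivalence relation on vertices generated by
`u ∼ v ↔ uΛv ≠ ∅` relates any two vertices. -/
def Connected (_G : KGraph k Λ) : Prop :=
  ∀ u v : Λ, Relation.EqvGen (fun x y : Λ => Nonempty (y ⟶ x)) u v

/-! ### The skeleton and the fundamental group -/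

/-- The vertex set of the `1`-skeleton of the `k`-graph. -/
@[ext]
structure Skeleton (G : KGraph k Λ) where
  vertex : Λ

/-- The `1`-skeleton: its edges are the morphisms of degree `e_i`, for some `i`. -/
instance : Quiver G.Skeleton where
  Hom u v := { f : u.vertex ⟶ v.vertex // ∃ i, G.d f = gen i }

/-- `UPath u v` is the set of undirected paths in the `1`-skeleton with source `u` and range `v`,
that is, of paths in the graph of edges and formal inverses of edges. -/
abbrev UPath (u v : G.Skeleton) : Type _ :=
  Quiver.Path (V := Quiver.Symmetrify G.Skeleton) u v

/-- The class of an undirected path in the fundamental groupoid of the `1`-skeleton, the quotient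
of the category of undirected paths by the cancellation relations. -/
def freeClass {u v : G.Skeleton} (p : G.UPath u v) :
    (Quiver.FreeGroupoid.of G.Skeleton).obj u ⟶ (Quiver.FreeGroupoid.of G.Skeleton).obj v :=
  (Quotient.functor (@Quiver.FreeGroupoid.redStep G.Skeleton _)).map
    (X := (Paths.of (Quiver.Symmetrify G.Skeleton)).obj u)
    (Y := (Paths.of (Quiver.Symmetrify G.Skeleton)).obj v) p

/-- The undirected path of length two that traverses `f` and then `e`; it is written `ef` in the
literature. -/
def path₂ {u v x : G.Skeleton} (f : u ⟶ v) (e : v ⟶ x) : G.UPath u x :=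
  (Quiver.Hom.toPath (V := Quiver.Symmetrify G.Skeleton) (Sum.inl f)).cons (Sum.inl e)

/-- The relations imposed by the commuting squares of the skeleton, on the fundamental groupoid of
the skeleton: `ef = gh` and `f⁻¹e⁻¹ = h⁻¹g⁻¹` whenever `e, h` have one colour, `f, g` have another
colour, and `ef = gh` in `Λ`. -/
inductive SquareRel : HomRel (Quiver.FreeGroupoid G.Skeleton)
  | square {u x y v : G.Skeleton} (f : u ⟶ x) (e : x ⟶ v) (h : u ⟶ y) (g : y ⟶ v)
      (i j : Fin k) (hij : i ≠ j) (he : G.d e.1 = gen i) (hf : G.d f.1 = gen j)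
      (hg : G.d g.1 = gen j) (hh : G.d h.1 = gen i) (comm : f.1 ≫ e.1 = h.1 ≫ g.1) :
      SquareRel (G.freeClass (G.path₂ f e)) (G.freeClass (G.path₂ h g))
  | square_inv {u x y v : G.Skeleton} (f : u ⟶ x) (e : x ⟶ v) (h : u ⟶ y) (g : y ⟶ v)
      (i j : Fin k) (hij : i ≠ j) (he : G.d e.1 = gen i) (hf : G.d f.1 = gen j)
      (hg : G.d g.1 = gen j) (hh : G.d h.1 = gen i) (comm : f.1 ≫ e.1 = h.1 ≫ g.1) :
      SquareRel (G.freeClass (G.path₂ f e).reverse) (G.freeClass (G.path₂ h g).reverse)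

/-- The fundamental groupoid of the `k`-graph: the quotient of the fundamental groupoid of the
skeleton by the commuting squares. -/
def FundamentalGroupoid : Type _ := Quotient G.SquareRel

instance : Groupoid G.FundamentalGroupoid :=
  inferInstanceAs (Groupoid (Quotient G.SquareRel))

/-- A vertex, as an object of the fundamental groupoid. -/
def toObj (v : Λ) : G.FundamentalGroupoid :=
  (Quotient.functor G.SquareRel).obj ((Quiver.FreeGroupoid.of G.Skeleton).obj ⟨v⟩)

/-- The fundamental group `π₁(Λ, v)`: the isotropy group of the fundamental groupoid at `v`.
The product `p * q` in `End` is `q ≫ p`, i.e. the composite `pq` of the literature. -/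
abbrev fundamentalGroup (v : Λ) : Type _ := End (G.toObj v)

/-- The class in `π₁(Λ, v)` of an undirected path from `v` to `v`. -/
def loopClass {v : Λ} (p : G.UPath ⟨v⟩ ⟨v⟩) : G.fundamentalGroup v :=
  (Quotient.functor G.SquareRel).map (G.freeClass p)

/-! ### The first homology group -/

/-- The set `⋃ᵢ Λ^{e_i}` of edges of the skeleton. -/
structure Edge where
  src : Λ
  tgt : Λ
  hom : src ⟶ tgt
  isEdge : ∃ i, G.d hom = gen i

/-- The disjoint union over `i < j` of the sets `Λ^{e_i + e_j}`. -/
structure Square where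
  src : Λ
  tgt : Λ
  hom : src ⟶ tgt
  i : Fin k
  j : Fin k
  lt : i < j
  deg : G.d hom = gen i + gen j

/-- Zero-chains: the free abelian group on the vertices. -/
abbrev C₀ (_G : KGraph k Λ) : Type _ := Λ →₀ ℤ

/-- One-chains: the free abelian group on the edges. -/
abbrev C₁ : Type _ := G.Edge →₀ ℤ

/-- Two-chains: the free abelian group on the morphisms of degree `e_i + e_j`, `i < j`. -/
abbrev C₂ : Type _ := G.Square →₀ ℤ

/-- The factor `μ` in the factorisation `lam = μν` with `d μ = e_i` and `d ν = e_j`. -/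
noncomputable def leftEdge {u v : Λ} (lam : u ⟶ v) (i j : Fin k)
    (h : G.d lam = gen i + gen j) : G.Edge :=
  ⟨_, _, (G.factorisation lam _ _ h).choose.2.2, i, (G.factorisation lam _ _ h).choose_spec.1.1⟩

/-- The factor `ν` in the factorisation `lam = μν` with `d μ = e_i` and `d ν = e_j`. -/
noncomputable def rightEdge {u v : Λ} (lam : u ⟶ v) (i j : Fin k)
    (h : G.d lam = gen i + gen j) : G.Edge :=
  ⟨_, _, (G.factorisation lam _ _ h).choose.2.1, j, (G.factorisation lam _ _ h).choose_spec.1.2.1⟩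

theorem Square.deg' {G : KGraph k Λ} (q : G.Square) : G.d q.hom = gen q.j + gen q.i :=
  q.deg.trans (add_comm _ _)

/-- The boundary map `∂₁(e) = s(e) - r(e)`. -/
noncomputable def boundary₁ : G.C₁ →ₗ[ℤ] G.C₀ :=
  Finsupp.linearCombination ℤ fun e : G.Edge =>
    (Finsupp.single e.src 1 - Finsupp.single e.tgt 1 : Λ →₀ ℤ)

/-- The boundary map `∂₂(lam) = f₁ + g₁ - f₂ - g₂`, where `lam = f₁g₁ = g₂f₂` with `f₁, f₂` of
degree `e_i` and `g₁, g₂` of degree `e_j`. -/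
noncomputable def boundary₂ : G.C₂ →ₗ[ℤ] G.C₁ :=
  Finsupp.linearCombination ℤ fun q : G.Square =>
    (Finsupp.single (G.leftEdge q.hom q.i q.j q.deg) 1
      + Finsupp.single (G.rightEdge q.hom q.i q.j q.deg) 1
      - Finsupp.single (G.rightEdge q.hom q.j q.i q.deg') 1
      - Finsupp.single (G.leftEdge q.hom q.j q.i q.deg') 1 : G.Edge →₀ ℤ)

theorem boundary₁_comp_boundary₂ : G.boundary₁ ∘ₗ G.boundary₂ = 0 := by
  ext q : 2
  simp only [boundary₁, boundary₂, LinearMap.comp_apply, Finsupp.lsingle_apply,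
    Finsupp.linearCombination_single, map_sub, map_add, one_smul, leftEdge, rightEdge,
    LinearMap.zero_apply]
  abel

/-- The first homology group `H₁(Λ) = ker ∂₁ / im ∂₂`. -/
abbrev H₁ : Type _ :=
  LinearMap.ker G.boundary₁ ⧸ (LinearMap.range G.boundary₂).submoduleOf (LinearMap.ker G.boundary₁)

/-- The class in `H₁(Λ)` of a one-cycle. -/
noncomputable def homologyClass (c : G.C₁) (hc : G.boundary₁ c = 0) : G.H₁ :=
  Submodule.Quotient.mk ⟨c, hc⟩

/-! ### Trails -/

/-- The one-chain of an edge of the skeleton or of a formal inverse of an edge: `e ↦ e` and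
`e⁻¹ ↦ -e`. -/
noncomputable def edgeChain {u v : G.Skeleton} :
    ((u ⟶ v) ⊕ (v ⟶ u)) → G.C₁
  | Sum.inl e => Finsupp.single ⟨u.vertex, v.vertex, e.1, e.2⟩ 1
  | Sum.inr e => -Finsupp.single ⟨v.vertex, u.vertex, e.1, e.2⟩ 1

/-- The trail `t(h) = ∑ᵢ mᵢ hᵢ` of an undirected path `h = h₁^{m₁} ⋯ hₙ^{mₙ}`, `mᵢ = ±1`. -/
noncomputable def trail {u : G.Skeleton} : {v : G.Skeleton} → G.UPath u v → G.C₁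
  | _, .nil => 0
  | _, .cons p e => trail p + G.edgeChain e

end KGraph

/-! Trails add under concatenation and change sign under reversal, so they respect cancellation; the
two sides of a commuting square have trails differing by an element of the image of `boundary₂`.
Hence any homomorphism on one-chains that kills boundaries induces a homomorphism on the fundamental
group (`classHom`).

Connectedness gives a base path `γ u` from `v` to each vertex `u`. Since trails of non-closed paths
are not cycles, the projection of cycles to `H₁` is first extended to all one-chains by closing them
up along `γ` (`closeUpClass`); this yields `hurewicz`. For the inverse, an edge from `a` to `b` is
sent to the abelianised class of the loop along `γ a`, the edge, then `γ b` reversed. In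
`edgeLoop_trail` the intermediate base paths cancel, so squares are respected. A loop at `v` comes
back conjugated by `γ v`, which is invisible after abelianising (`loopHom_loopClass`). In the other
direction, closing up fixes cycles (`hurewicz_edgeLoop`, `closeUp_of_cycle`). -/

namespace KGraph

variable {k : ℕ} {Λ : Type u} [Category.{w} Λ] (G : KGraph k Λ)

/-! ### Trails -/

/-- An arrow of the skeleton, as an edge. -/
def toEdge {u v : G.Skeleton} (e : u ⟶ v) : G.Edge :=
  ⟨u.vertex, v.vertex, e.1, e.2⟩

theorem trail_comp {u v x : G.Skeleton} (p : G.UPath u v) (q : G.UPath v x) :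
    G.trail (p.comp q) = G.trail p + G.trail q := by
  induction q with
  | nil => exact (add_zero _).symm
  | cons q e ih =>
    change G.trail (p.comp q) + _ = G.trail p + (G.trail q + _)
    rw [ih, add_assoc]

theorem trail_toPath {u v : G.Skeleton} (e : (u ⟶ v) ⊕ (v ⟶ u)) :
    G.trail (Quiver.Hom.toPath (V := Quiver.Symmetrify G.Skeleton) e) = G.edgeChain e :=
  zero_add _

theorem edgeChain_swap {u v : G.Skeleton} (e : (u ⟶ v) ⊕ (v ⟶ u)) :
    G.edgeChain e.swap = -G.edgeChain e := by
  rcases e with e | e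
  · rfl
  · exact (neg_neg _).symm

theorem trail_reverse {u v : G.Skeleton} (p : G.UPath u v) :
    G.trail (Quiver.Path.reverse p) = -G.trail p := by
  induction p with
  | nil => exact neg_zero.symm
  | cons p e ih =>
    refine (G.trail_comp _ _).trans ?_
    rw [ih]
    refine (congrArg (· + _) ((G.trail_toPath _).trans (G.edgeChain_swap e))).trans ?_
    exact (neg_add_rev _ _).symm

theorem boundary₁_edgeChain {u v : G.Skeleton} (e : (u ⟶ v) ⊕ (v ⟶ u)) :
    G.boundary₁ (G.edgeChain e) = Finsupp.single u.vertex 1 - Finsupp.single v.vertex 1 := by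
  rcases e with e | e <;> simp [edgeChain, boundary₁]

theorem boundary₁_trail {u v : G.Skeleton} (p : G.UPath u v) :
    G.boundary₁ (G.trail p) = Finsupp.single u.vertex 1 - Finsupp.single v.vertex 1 := by
  induction p with
  | nil => exact (map_zero _).trans (sub_self _).symm
  | cons p e ih =>
    refine (map_add _ _ _).trans ?_
    rw [ih, boundary₁_edgeChain]
    abel

theorem trail_path₂ {u v x : G.Skeleton} (f : u ⟶ v) (e : v ⟶ x) :
    G.trail (G.path₂ f e) = Finsupp.single (G.toEdge f) 1 + Finsupp.single (G.toEdge e) 1 :=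
  congrArg (· + _) (zero_add _)

/-! ### Commuting squares -/

theorem leftEdge_comp {u v x : G.Skeleton} (f : u ⟶ x) (e : x ⟶ v) {i j : Fin k}
    (he : G.d e.1 = gen i) (hf : G.d f.1 = gen j) (h : G.d (f.1 ≫ e.1) = gen i + gen j) :
    G.leftEdge (f.1 ≫ e.1) i j h = G.toEdge e := by
  have hu := (G.factorisation _ _ _ h).choose_spec.2 ⟨x.vertex, f.1, e.1⟩ ⟨he, hf, rfl⟩
  -- The endpoint of the chosen factor depends on the chosen triple, so the triple is generalised
  -- before substituting.
  have key : ∀ (p : Σ y : Λ, (u.vertex ⟶ y) × (y ⟶ v.vertex)) (hp : ∃ i, G.d p.2.2 = gen i),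
      (⟨x.vertex, f.1, e.1⟩ : Σ y : Λ, (u.vertex ⟶ y) × (y ⟶ v.vertex)) = p →
        (⟨_, _, p.2.2, hp⟩ : G.Edge) = G.toEdge e := by
    rintro p hp rfl
    rfl
  exact key _ _ hu

theorem rightEdge_comp {u v x : G.Skeleton} (f : u ⟶ x) (e : x ⟶ v) {i j : Fin k}
    (he : G.d e.1 = gen i) (hf : G.d f.1 = gen j) (h : G.d (f.1 ≫ e.1) = gen i + gen j) :
    G.rightEdge (f.1 ≫ e.1) i j h = G.toEdge f := by
  have hu := (G.factorisation _ _ _ h).choose_spec.2 ⟨x.vertex, f.1, e.1⟩ ⟨he, hf, rfl⟩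
  have key : ∀ (p : Σ y : Λ, (u.vertex ⟶ y) × (y ⟶ v.vertex)) (hp : ∃ i, G.d p.2.1 = gen i),
      (⟨x.vertex, f.1, e.1⟩ : Σ y : Λ, (u.vertex ⟶ y) × (y ⟶ v.vertex)) = p →
        (⟨_, _, p.2.1, hp⟩ : G.Edge) = G.toEdge f := by
    rintro p hp rfl
    rfl
  exact key _ _ hu

/-- The boundary of the square with sides `e, f, g, h`. -/
theorem boundary₂_square {u x y v : G.Skeleton} (f : u ⟶ x) (e : x ⟶ v) (h : u ⟶ y) (g : y ⟶ v)
    {i j : Fin k} (hij : i < j) (he : G.d e.1 = gen i) (hf : G.d f.1 = gen j)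
    (hg : G.d g.1 = gen j) (hh : G.d h.1 = gen i) (comm : f.1 ≫ e.1 = h.1 ≫ g.1)
    (hd : G.d (f.1 ≫ e.1) = gen i + gen j) :
    G.boundary₂ (Finsupp.single ⟨_, _, f.1 ≫ e.1, i, j, hij, hd⟩ 1) =
      G.trail (G.path₂ f e) - G.trail (G.path₂ h g) := by
  have hd' : G.d (f.1 ≫ e.1) = gen j + gen i := hd.trans (add_comm _ _)
  have h₁ : G.leftEdge (f.1 ≫ e.1) j i hd' = G.toEdge g := by
    rw! [comm]
    exact G.leftEdge_comp h g hg hh _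
  have h₂ : G.rightEdge (f.1 ≫ e.1) j i hd' = G.toEdge h := by
    rw! [comm]
    exact G.rightEdge_comp h g hg hh _
  simp only [boundary₂, Finsupp.linearCombination_single, one_smul, trail_path₂, h₁, h₂,
    G.leftEdge_comp f e he hf, G.rightEdge_comp f e he hf]
  abel

theorem trail_sub_trail_mem_range {u x y v : G.Skeleton} (f : u ⟶ x) (e : x ⟶ v) (h : u ⟶ y)
    (g : y ⟶ v) {i j : Fin k} (hij : i ≠ j) (he : G.d e.1 = gen i) (hf : G.d f.1 = gen j)
    (hg : G.d g.1 = gen j) (hh : G.d h.1 = gen i) (comm : f.1 ≫ e.1 = h.1 ≫ g.1) :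
    G.trail (G.path₂ f e) - G.trail (G.path₂ h g) ∈ LinearMap.range G.boundary₂ := by
  rcases hij.lt_or_gt with hlt | hlt
  · exact ⟨_, G.boundary₂_square f e h g hlt he hf hg hh comm (by rw [G.d_comp, he, hf, add_comm])⟩
  -- Two-chains are generated by squares with ordered colours, so here the two sides swap roles and
  -- the sign changes.
  · rw [← neg_sub]
    exact neg_mem
      ⟨_, G.boundary₂_square h g f e hlt hg hh he hf comm.symm (by rw [G.d_comp, hg, hh, add_comm])⟩

/-- Every generator of the two-chains comes from a commuting square of the skeleton. -/
theorem Square.exists_sides {G : KGraph k Λ} (q : G.Square) :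
    ∃ (u x y v : G.Skeleton) (f : u ⟶ x) (e : x ⟶ v) (h : u ⟶ y) (g : y ⟶ v) (i j : Fin k),
      i ≠ j ∧ G.d e.1 = gen i ∧ G.d f.1 = gen j ∧ G.d g.1 = gen j ∧ G.d h.1 = gen i ∧
        f.1 ≫ e.1 = h.1 ≫ g.1 ∧
        G.boundary₂ (Finsupp.single q 1) = G.trail (G.path₂ f e) - G.trail (G.path₂ h g) := by
  obtain ⟨u, v, lam, i, j, hij, hd⟩ := q
  obtain ⟨⟨x, f, e⟩, ⟨he, hf, hfe⟩, -⟩ := G.factorisation lam (gen i) (gen j) hd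
  obtain ⟨⟨y, h, g⟩, ⟨hg, hh, hhg⟩, -⟩ :=
    G.factorisation lam (gen j) (gen i) (hd.trans (add_comm _ _))
  dsimp only at he hf hfe hg hh hhg
  subst hfe
  exact ⟨⟨u⟩, ⟨x⟩, ⟨y⟩, ⟨v⟩, ⟨f, j, hf⟩, ⟨e, i, he⟩, ⟨h, i, hh⟩, ⟨g, j, hg⟩, i, j, hij.ne, he, hf,
    hg, hh, hhg.symm, G.boundary₂_square (u := ⟨u⟩) (x := ⟨x⟩) (y := ⟨y⟩) (v := ⟨v⟩)
      ⟨f, j, hf⟩ ⟨e, i, he⟩ ⟨h, i, hh⟩ ⟨g, j, hg⟩ hij he hf hg hh hhg.symm hd⟩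

/-! ### Classes of undirected paths -/

/-- The class of an undirected path in the fundamental groupoid of the `k`-graph. -/
def pathClass {u v : G.Skeleton} (p : G.UPath u v) : G.toObj u.vertex ⟶ G.toObj v.vertex :=
  (Quotient.functor G.SquareRel).map (G.freeClass p)

theorem pathClass_reverse {u v : G.Skeleton} (p : G.UPath u v) :
    G.pathClass (Quiver.Path.reverse p) = Groupoid.inv (G.pathClass p) :=
  rfl

/-- Both quotient functors are full. -/
theorem pathClass_surjective {u v : G.Skeleton} (g : G.toObj u.vertex ⟶ G.toObj v.vertex) :
    ∃ p : G.UPath u v, G.pathClass p = g := by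
  obtain ⟨g, rfl⟩ := (Quotient.functor G.SquareRel).map_surjective g
  obtain ⟨p, rfl⟩ :=
    (Quotient.functor (@Quiver.FreeGroupoid.redStep G.Skeleton _)).map_surjective g
  exact ⟨p, rfl⟩

/-! ### Homomorphisms out of the fundamental group -/

section Lift

variable {G} {A : Type*} [AddCommGroup A] (φ : G.C₁ →ₗ[ℤ] A)

/-- The functor from undirected paths to `A` given by applying `φ` to trails. -/
noncomputable def trailFunctor : Paths (Quiver.Symmetrify G.Skeleton) ⥤ SingleObj (Multiplicative A) where
  obj _ := SingleObj.star _
  map p := Multiplicative.ofAdd (φ (G.trail p))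
  map_id _ := congrArg Multiplicative.ofAdd (map_zero φ)
  map_comp p q := by
    refine congrArg Multiplicative.ofAdd ((congrArg φ (G.trail_comp p q)).trans ?_)
    -- Composition in `SingleObj` is multiplication in the opposite order.
    rw [map_add, add_comm]
    rfl

/-- The functor induced by `trailFunctor` on the fundamental groupoid of the skeleton. -/
noncomputable def freeTrailFunctor : Quiver.FreeGroupoid G.Skeleton ⥤ SingleObj (Multiplicative A) :=
  CategoryTheory.Quotient.lift _ (trailFunctor φ) <| by
    rintro _ _ _ _ ⟨X, Z, f⟩
    refine congrArg (fun c => Multiplicative.ofAdd (φ c)) ?_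
    refine Eq.trans ?_ (G.trail_comp _ _).symm
    refine Eq.trans ?_ (congrArg₂ (· + ·) (G.trail_toPath _)
      ((G.trail_toPath _).trans (G.edgeChain_swap f))).symm
    exact (add_neg_cancel _).symm

theorem freeTrailFunctor_map {u v : G.Skeleton} (p : G.UPath u v) :
    (freeTrailFunctor φ).map (G.freeClass p) = Multiplicative.ofAdd (φ (G.trail p)) :=
  rfl

variable (hφ : φ ∘ₗ G.boundary₂ = 0)

/-- The functor induced on the fundamental groupoid by a homomorphism on one-chains which
vanishes on boundaries. -/
noncomputable def classFunctor : G.FundamentalGroupoid ⥤ SingleObj (Multiplicative A) :=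
  CategoryTheory.Quotient.lift _ (freeTrailFunctor φ) <| by
    have key : ∀ c ∈ LinearMap.range G.boundary₂, φ c = 0 := by
      rintro _ ⟨c, rfl⟩
      exact LinearMap.congr_fun hφ c
    rintro _ _ _ _ (⟨f, e, h, g, i, j, hij, he, hf, hg, hh, comm⟩ |
      ⟨f, e, h, g, i, j, hij, he, hf, hg, hh, comm⟩)
    · rw [freeTrailFunctor_map, freeTrailFunctor_map]
      refine congrArg Multiplicative.ofAdd (sub_eq_zero.1 ?_)
      rw [← map_sub]
      exact key _ (G.trail_sub_trail_mem_range f e h g hij he hf hg hh comm)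
    · rw [freeTrailFunctor_map, freeTrailFunctor_map, trail_reverse, trail_reverse]
      refine congrArg Multiplicative.ofAdd (sub_eq_zero.1 ?_)
      rw [← map_sub, neg_sub_neg, ← neg_sub, map_neg,
        key _ (G.trail_sub_trail_mem_range f e h g hij he hf hg hh comm), neg_zero]

/-- The homomorphism induced on the fundamental group by a homomorphism on one-chains which
vanishes on boundaries. -/
noncomputable def classHom (v : Λ) : G.fundamentalGroup v →* Multiplicative A where
  toFun g := (classFunctor φ hφ).map g
  map_one' := (classFunctor φ hφ).map_id _
  map_mul' g h := (classFunctor φ hφ).map_comp h g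

end Lift

/-! ### Connectedness -/

/-- Placing an identity on either side gives two factorisations of degree `0 + 0`; uniqueness
identifies their middle vertices. -/
theorem eq_of_d_eq_zero {u v : Λ} (lam : u ⟶ v) (h : G.d lam = 0) : u = v := by
  obtain ⟨p, -, hp⟩ := G.factorisation lam 0 0 (h.trans (add_zero _).symm)
  have h₁ := hp ⟨u, 𝟙 u, lam⟩ ⟨h, G.d_id _, Category.id_comp _⟩
  have h₂ := hp ⟨v, lam, 𝟙 v⟩ ⟨G.d_id _, h, Category.comp_id _⟩
  exact congrArg Sigma.fst (h₁.trans h₂.symm)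

/-- Induction on total degree, splitting off one edge at the range. -/
theorem nonempty_uPath_of_hom (n : ℕ) : ∀ {u v : Λ} (lam : u ⟶ v), ∑ i, G.d lam i = n →
    Nonempty (G.UPath ⟨u⟩ ⟨v⟩) := by
  induction n with
  | zero =>
    intro u v lam h
    have h0 : G.d lam = 0 := by
      ext i
      exact Finset.sum_eq_zero_iff.1 h i (Finset.mem_univ i)
    obtain rfl := G.eq_of_d_eq_zero lam h0
    exact ⟨.nil⟩
  | succ n ih =>
    intro u v lam h
    obtain ⟨i, hi⟩ : ∃ i, G.d lam i ≠ 0 := by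
      by_contra! hc
      simp [hc] at h
    have hle : gen i ≤ G.d lam := by
      intro j
      rcases eq_or_ne j i with rfl | hj
      · simpa [gen] using Nat.one_le_iff_ne_zero.2 hi
      · simp [gen, hj]
    obtain ⟨⟨x, f, e⟩, ⟨he, hf, -⟩, -⟩ :=
      G.factorisation lam (gen i) (G.d lam - gen i) (add_tsub_cancel_of_le hle).symm
    have hs : ∑ j, G.d f j = n := by
      have h₁ : ∑ j, G.d lam j = ∑ j, (gen i j + G.d f j) := by
        refine Finset.sum_congr rfl fun j _ => ?_
        have := congrFun (add_tsub_cancel_of_le hle) j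
        rw [← hf] at this
        exact this.symm
      rw [Finset.sum_add_distrib, h] at h₁
      have h₂ : ∑ j, (gen i : Fin k → ℕ) j = 1 := by simp [gen]
      omega
    obtain ⟨p⟩ := ih f hs
    exact ⟨Quiver.Path.cons p (Sum.inl (⟨e, i, he⟩ : (⟨x⟩ : G.Skeleton) ⟶ ⟨v⟩))⟩

theorem Connected.nonempty_uPath {G : KGraph k Λ} (hG : G.Connected) (u v : Λ) :
    Nonempty (G.UPath ⟨u⟩ ⟨v⟩) := by
  induction hG u v with
  | rel x y h =>
    obtain ⟨f⟩ := h
    obtain ⟨p⟩ := G.nonempty_uPath_of_hom _ f rfl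
    exact ⟨Quiver.Path.reverse p⟩
  | refl x => exact ⟨.nil⟩
  | symm x y _ ih => exact ih.map Quiver.Path.reverse
  | trans x y z _ _ ih₁ ih₂ => exact ih₁.elim fun p => ih₂.map p.comp

/-! ### The isomorphism -/

section BasePaths

variable {G} {v : Λ} (γ : ∀ u : Λ, G.UPath ⟨v⟩ ⟨u⟩)

/-- The one-chain `e` closed up to a cycle along the base paths `γ`. -/
noncomputable def closeUp : G.C₁ →ₗ[ℤ] G.C₁ :=
  LinearMap.id + Finsupp.linearCombination ℤ (fun u => G.trail (γ u)) ∘ₗ G.boundary₁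

theorem closeUp_of_cycle {c : G.C₁} (hc : G.boundary₁ c = 0) : closeUp γ c = c := by
  simp [closeUp, hc]

/-- For an edge from `a` to `b` the correction is the trail of `γ a` minus that of `γ b`, with
boundary `b - a`. -/
theorem boundary₁_closeUp (c : G.C₁) : G.boundary₁ (closeUp γ c) = 0 := by
  have h : G.boundary₁ ∘ₗ closeUp γ = 0 := by
    ext e : 2
    have he : G.boundary₁ (Finsupp.single e 1) =
        Finsupp.single e.src 1 - Finsupp.single e.tgt 1 := by simp [boundary₁]
    simp [closeUp, he, boundary₁_trail]
  exact LinearMap.congr_fun h c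

/-- The homology class of the cycle obtained by closing up a one-chain along `γ`. -/
noncomputable def closeUpClass : G.C₁ →ₗ[ℤ] G.H₁ :=
  Submodule.mkQ _ ∘ₗ (closeUp γ).codRestrict _ (boundary₁_closeUp γ)

theorem closeUpClass_of_cycle {c : G.C₁} (hc : G.boundary₁ c = 0) :
    closeUpClass γ c = G.homologyClass c hc :=
  congrArg Submodule.Quotient.mk (Subtype.ext (closeUp_of_cycle γ hc))

theorem closeUpClass_comp_boundary₂ : closeUpClass γ ∘ₗ G.boundary₂ = 0 := by
  refine LinearMap.ext fun c => ?_
  have hc : G.boundary₁ (G.boundary₂ c) = 0 := LinearMap.congr_fun G.boundary₁_comp_boundary₂ c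
  refine (closeUpClass_of_cycle γ hc).trans ?_
  exact (Submodule.Quotient.mk_eq_zero _).2 ⟨c, rfl⟩

/-- The loop obtained by closing up a morphism of the fundamental groupoid along `γ`. -/
def closeLoop {a b : Λ} (g : G.toObj a ⟶ G.toObj b) : G.fundamentalGroup v :=
  End.of (G.pathClass (γ a) ≫ g ≫ Groupoid.inv (G.pathClass (γ b)))

/-- The class of `closeLoop` in the abelianised fundamental group. -/
def loopHom {a b : Λ} (g : G.toObj a ⟶ G.toObj b) :
    Additive (Abelianization (G.fundamentalGroup v)) :=
  Additive.ofMul (Abelianization.of (closeLoop γ g))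

theorem closeLoop_comp {a b c : Λ} (g : G.toObj a ⟶ G.toObj b) (h : G.toObj b ⟶ G.toObj c) :
    closeLoop γ (g ≫ h) = closeLoop γ h * closeLoop γ g := by
  rw [End.mul_def]
  simp [closeLoop]

theorem loopHom_comp {a b c : Λ} (g : G.toObj a ⟶ G.toObj b) (h : G.toObj b ⟶ G.toObj c) :
    loopHom γ (g ≫ h) = loopHom γ g + loopHom γ h := by
  rw [loopHom, closeLoop_comp, map_mul, mul_comm]
  rfl

/-- The value `x` at an idempotent satisfies `x = x + x`. -/
theorem loopHom_id (a : Λ) : loopHom γ (𝟙 (G.toObj a)) = 0 := by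
  have h := loopHom_comp γ (𝟙 (G.toObj a)) (𝟙 (G.toObj a))
  rw [Category.comp_id] at h
  exact left_eq_add.1 h

theorem loopHom_inv {a b : Λ} (g : G.toObj a ⟶ G.toObj b) :
    loopHom γ (Groupoid.inv g) = -loopHom γ g := by
  rw [eq_neg_iff_add_eq_zero, ← loopHom_comp, Groupoid.inv_comp, loopHom_id]

theorem loopHom_loopClass (p : G.UPath ⟨v⟩ ⟨v⟩) :
    loopHom γ (G.loopClass p) = Additive.ofMul (Abelianization.of (G.loopClass p)) := by
  have key : closeLoop γ (G.loopClass p) =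
      (G.loopClass (γ v))⁻¹ * G.loopClass p * G.loopClass (γ v) := by
    rw [End.mul_def, End.mul_def]
    rfl
  refine congrArg Additive.ofMul ?_
  rw [key, map_mul, map_mul, map_inv, mul_right_comm, inv_mul_cancel, one_mul]

/-- The homomorphism from one-chains to the abelianised fundamental group which closes up edges
along `γ`. -/
noncomputable def edgeLoop : G.C₁ →ₗ[ℤ] Additive (Abelianization (G.fundamentalGroup v)) :=
  Finsupp.linearCombination ℤ fun e : G.Edge =>
    loopHom γ (G.pathClass (u := ⟨e.src⟩) (v := ⟨e.tgt⟩)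
      (Quiver.Hom.toPath (V := Quiver.Symmetrify G.Skeleton) (Sum.inl ⟨e.hom, e.isEdge⟩)))

theorem edgeLoop_single {a b : G.Skeleton} (e : a ⟶ b) :
    edgeLoop γ (Finsupp.single (G.toEdge e) 1) = loopHom γ (G.pathClass
      (Quiver.Hom.toPath (V := Quiver.Symmetrify G.Skeleton) (Sum.inl e))) := by
  rw [edgeLoop, Finsupp.linearCombination_single, one_smul]
  rfl

theorem edgeLoop_edgeChain {a b : G.Skeleton} (e : (a ⟶ b) ⊕ (b ⟶ a)) :
    edgeLoop γ (G.edgeChain e) =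
      loopHom γ (G.pathClass (Quiver.Hom.toPath (V := Quiver.Symmetrify G.Skeleton) e)) := by
  rcases e with e | e
  · exact edgeLoop_single γ e
  · refine (map_neg _ _).trans ((congrArg _ (edgeLoop_single γ e)).trans ?_)
    rw [← loopHom_inv, ← pathClass_reverse]
    rfl

theorem edgeLoop_trail {a b : G.Skeleton} (p : G.UPath a b) :
    edgeLoop γ (G.trail p) = loopHom γ (G.pathClass p) := by
  induction p with
  | nil => exact (map_zero _).trans (loopHom_id γ a.vertex).symm
  | cons p e ih =>
    refine (map_add _ _ _).trans ?_
    rw [ih, edgeLoop_edgeChain, ← loopHom_comp]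
    rfl

theorem edgeLoop_comp_boundary₂ : edgeLoop γ ∘ₗ G.boundary₂ = 0 := by
  ext q : 2
  obtain ⟨u, x, y, v, f, e, h, g, i, j, hij, he, hf, hg, hh, comm, hq⟩ := q.exists_sides
  have hrel : G.pathClass (G.path₂ f e) = G.pathClass (G.path₂ h g) :=
    CategoryTheory.Quotient.sound _ (.square f e h g i j hij he hf hg hh comm)
  simp only [LinearMap.comp_apply, Finsupp.lsingle_apply, LinearMap.zero_apply]
  rw [hq, map_sub, edgeLoop_trail, edgeLoop_trail, hrel, sub_self]

/-- The Hurewicz homomorphism, which sends the class of a loop to the class of its trail. -/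
noncomputable def hurewicz :
    Additive (Abelianization (G.fundamentalGroup v)) →+ G.H₁ :=
  MonoidHom.toAdditiveLeft
    (Abelianization.lift (classHom (closeUpClass γ) (closeUpClass_comp_boundary₂ γ) v))

theorem hurewicz_loopClass (p : G.UPath ⟨v⟩ ⟨v⟩) :
    hurewicz γ (Additive.ofMul (Abelianization.of (G.loopClass p))) =
      closeUpClass γ (G.trail p) :=
  rfl

theorem hurewicz_edgeLoop (c : G.C₁) : hurewicz γ (edgeLoop γ c) = closeUpClass γ c := by
  have h : (hurewicz γ).toIntLinearMap ∘ₗ edgeLoop γ = closeUpClass γ := by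
    ext ⟨a, b, e, he⟩ : 2
    let e' : (⟨a⟩ : G.Skeleton) ⟶ ⟨b⟩ := ⟨e, he⟩
    let p : G.UPath ⟨a⟩ ⟨b⟩ := Quiver.Hom.toPath (V := Quiver.Symmetrify G.Skeleton) (Sum.inl e')
    -- The loop `q` represents `edgeLoop` of the edge, and its trail is exactly the closed-up edge.
    let q : G.UPath ⟨v⟩ ⟨v⟩ := (γ a).comp (p.comp (Quiver.Path.reverse (γ b)))
    have hq : edgeLoop γ (Finsupp.single (G.toEdge e') 1) =
        Additive.ofMul (Abelianization.of (G.loopClass q)) := edgeLoop_single γ e'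
    refine (congrArg (hurewicz γ) hq).trans ((hurewicz_loopClass γ q).trans ?_)
    refine congrArg (Submodule.mkQ _) (Subtype.ext ?_)
    have hcyc : G.boundary₁ (G.trail q) = 0 := (G.boundary₁_trail q).trans (sub_self _)
    refine (closeUp_of_cycle γ hcyc).trans ?_
    have ht : G.trail q =
        G.trail (γ a) + (Finsupp.single (G.toEdge e') 1 + -G.trail (γ b)) := by
      rw [trail_comp, trail_comp, trail_reverse, trail_toPath]
      rfl
    have he' : closeUp γ (Finsupp.single (G.toEdge e') 1) =
        Finsupp.single (G.toEdge e') 1 + (G.trail (γ a) - G.trail (γ b)) := by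
      simp [closeUp, boundary₁, toEdge]
    refine Eq.trans ?_ he'.symm
    rw [ht]
    abel
  exact LinearMap.congr_fun h c

/-- The inverse of the Hurewicz homomorphism. -/
noncomputable def hurewiczInv :
    G.H₁ →ₗ[ℤ] Additive (Abelianization (G.fundamentalGroup v)) :=
  Submodule.liftQ _ (edgeLoop γ ∘ₗ (LinearMap.ker G.boundary₁).subtype) <| by
    rintro c ⟨b, hb⟩
    refine (congrArg (edgeLoop γ) hb.symm).trans ?_
    exact LinearMap.congr_fun (edgeLoop_comp_boundary₂ γ) b

theorem hurewiczInv_homologyClass (c : G.C₁) (hc : G.boundary₁ c = 0) :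
    hurewiczInv γ (G.homologyClass c hc) = edgeLoop γ c :=
  rfl

/-- The Hurewicz isomorphism. -/
noncomputable def hurewiczEquiv :
    Additive (Abelianization (G.fundamentalGroup v)) ≃+ G.H₁ where
  __ := hurewicz γ
  invFun := hurewiczInv γ
  left_inv x := by
    obtain ⟨g, rfl⟩ := QuotientGroup.mk_surjective (Additive.toMul x)
    obtain ⟨p, rfl⟩ := G.pathClass_surjective (u := ⟨v⟩) (v := ⟨v⟩) g
    have hc : G.boundary₁ (G.trail p) = 0 := (G.boundary₁_trail p).trans (sub_self _)
    refine (congrArg (hurewiczInv γ)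
      ((hurewicz_loopClass γ p).trans (closeUpClass_of_cycle γ hc))).trans ?_
    rw [hurewiczInv_homologyClass, edgeLoop_trail]
    exact loopHom_loopClass γ p
  right_inv x := by
    obtain ⟨⟨c, hc⟩, rfl⟩ := Submodule.Quotient.mk_surjective _ x
    exact (hurewicz_edgeLoop γ c).trans (closeUpClass_of_cycle γ hc)

end BasePaths

end KGraph

theorem mainTheorem10 {k : ℕ} {Λ : Type u} [Category.{w} Λ] (G : KGraph k Λ)
    (hG : G.Connected) (v : Λ) :
    ∃ Φ : Additive (Abelianization (G.fundamentalGroup v)) ≃+ G.H₁,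
      ∀ h : G.UPath ⟨v⟩ ⟨v⟩,
        ∃ hc : G.boundary₁ (G.trail h) = 0,
          Φ (Additive.ofMul (Abelianization.of (G.loopClass h))) =
            G.homologyClass (G.trail h) hc := by
  let γ (u : Λ) : G.UPath ⟨v⟩ ⟨u⟩ := (hG.nonempty_uPath v u).some
  refine ⟨KGraph.hurewiczEquiv γ, fun h => ?_⟩
  have hc : G.boundary₁ (G.trail h) = 0 := (G.boundary₁_trail h).trans (sub_self _)
  exact ⟨hc, (KGraph.hurewicz_loopClass _ h).trans (KGraph.closeUpClass_of_cycle _ hc)⟩
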